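/- Let $X$ be a real $n\times n$ matrix and let $\Sigma_{n\times n}$ be the set of $n\times n$ doubly stochastic matrices. Write $\langle A,B\rangle=\operatorname{tr}(A^TB)$ and let $\|\cdot\|$ be the Frobenius norm. For $\beta>0$ let $S^\beta_X$ be the unique maximizer over $S\in\Sigma_{n\times n}$ of $$\langle S,X\rangle+\frac1\beta\mathcal H(S),\qquad \mathcal H(S)=-\sum_{i,j}S_{ij}\ln S_{ij}\quad(0\ln 0=0).$$ Then the limit $S^\infty_X=\lim_{\beta\to\infty}S^\beta_X$ exists, lies in $\Sigma_{n\times n}$, and is an optimal solution of the linear assignment problem $\max_{S\in\Sigma_{n\times n}}\langle S,X\rangle$. For every $\beta>0$, $$|\langle S^\beta_X,X\rangle-\langle S^\infty_X,X\rangle|\le\|S^\beta_X-S^\infty_X\|\,\|X\|.$$ Moreover there are constants $c>0$ and $\mu>0$ (which may depend on $X$ but not on $\beta$) such that for every $\beta>0$ $$\|S^\beta_X-S^\infty_X\|\le\frac{c}{\mu}e^{-\mu\beta}.$$ -/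

import Mathlib

open Filter Topology

-- `‖A‖` on matrices is the Frobenius norm.
attribute [local instance] Matrix.frobeniusNormedAddCommGroup

noncomputable section

/-- The Frobenius inner product `⟨A, B⟩ = tr (Aᵀ B) = ∑ A i j * B i j` of real matrices. -/
def frobeniusInner {n : ℕ} (A B : Matrix (Fin n) (Fin n) ℝ) : ℝ :=
  (A.transpose * B).trace

/-- The entropy `- ∑ S i j * log (S i j)` of a matrix, with the convention `0 log 0 = 0`. -/
def matrixEntropy {n : ℕ} (S : Matrix (Fin n) (Fin n) ℝ) : ℝ :=
  ∑ i, ∑ j, Real.negMulLog (S i j)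

/-- The entropically regularized assignment score `⟨S, X⟩ + (1 / β) H(S)`. -/
def softassignScore {n : ℕ} (X : Matrix (Fin n) (Fin n) ℝ) (β : ℝ)
    (S : Matrix (Fin n) (Fin n) ℝ) : ℝ :=
  frobeniusInner S X + 1 / β * matrixEntropy S

theorem frobeniusInner_eq_sum {n : ℕ} (A B : Matrix (Fin n) (Fin n) ℝ) :
    frobeniusInner A B = ∑ i, ∑ j, A i j * B i j := by
  simp only [frobeniusInner, Matrix.trace, Matrix.diag, Matrix.mul_apply, Matrix.transpose_apply]
  exact Finset.sum_comm

theorem isCompact_doublyStochastic (n : ℕ) :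
    IsCompact {S : Matrix (Fin n) (Fin n) ℝ | S ∈ doublyStochastic ℝ (Fin n)} := by
  have hK : IsCompact (Set.pi Set.univ fun _ : Fin n =>
      Set.pi Set.univ fun _ : Fin n => Set.Icc (0 : ℝ) 1) :=
    isCompact_univ_pi fun _ => isCompact_univ_pi fun _ => isCompact_Icc
  have hc : ∀ i j, Continuous fun S : Fin n → Fin n → ℝ => S i j := fun i j => by fun_prop
  refine hK.of_isClosed_subset ?_ ?_
  · have : {S : Matrix (Fin n) (Fin n) ℝ | S ∈ doublyStochastic ℝ (Fin n)} =
        (⋂ i, ⋂ j, {S | 0 ≤ S i j}) ∩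
          ((⋂ i, {S | ∑ j, S i j = 1}) ∩ ⋂ j, {S | ∑ i, S i j = 1}) := by
      ext S
      simp [mem_doublyStochastic_iff_sum]
    rw [this]
    refine IsClosed.inter ?_ (IsClosed.inter ?_ ?_)
    · exact isClosed_iInter fun i => isClosed_iInter fun j =>
        isClosed_le continuous_const (hc i j)
    · exact isClosed_iInter fun i =>
        isClosed_eq (continuous_finsetSum _ fun j _ => hc i j) continuous_const
    · exact isClosed_iInter fun j =>
        isClosed_eq (continuous_finsetSum _ fun i _ => hc i j) continuous_const
  · intro S hS i _ j _
    exact ⟨nonneg_of_mem_doublyStochastic hS, le_one_of_mem_doublyStochastic hS⟩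

theorem exists_softassign {n : ℕ} (X : Matrix (Fin n) (Fin n) ℝ) (β : ℝ) :
    ∃ S ∈ doublyStochastic ℝ (Fin n),
      ∀ T ∈ doublyStochastic ℝ (Fin n), softassignScore X β T ≤ softassignScore X β S := by
  have hc : ∀ i j, Continuous fun S : Matrix (Fin n) (Fin n) ℝ => S i j :=
    fun i j => (continuous_apply j).comp (continuous_apply i)
  have hcont : Continuous (softassignScore X β) := by
    unfold softassignScore matrixEntropy
    simp only [frobeniusInner_eq_sum]
    refine Continuous.add ?_ (continuous_const.mul ?_)
    · exact continuous_finsetSum _ fun i _ => continuous_finsetSum _ fun j _ =>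
        (hc i j).mul continuous_const
    · exact continuous_finsetSum _ fun i _ => continuous_finsetSum _ fun j _ =>
        Real.continuous_negMulLog.comp (hc i j)
  obtain ⟨S, hS, hmax⟩ := (isCompact_doublyStochastic n).exists_isMaxOn
    ⟨1, (doublyStochastic ℝ (Fin n)).one_mem⟩ hcont.continuousOn
  exact ⟨S, hS, fun T hT => hmax hT⟩

/-- The matrix `S^β_X`: the maximizer of `⟨S, X⟩ + (1 / β) H(S)` over the doubly stochastic
matrices. It exists by compactness, and for `β > 0` it is unique (`softassign_unique`). -/
def softassign {n : ℕ} (X : Matrix (Fin n) (Fin n) ℝ) (β : ℝ) : Matrix (Fin n) (Fin n) ℝ :=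
  (exists_softassign X β).choose

theorem softassign_mem {n : ℕ} (X : Matrix (Fin n) (Fin n) ℝ) (β : ℝ) :
    softassign X β ∈ doublyStochastic ℝ (Fin n) :=
  (exists_softassign X β).choose_spec.1

theorem softassign_max {n : ℕ} (X : Matrix (Fin n) (Fin n) ℝ) (β : ℝ)
    (T : Matrix (Fin n) (Fin n) ℝ) (hT : T ∈ doublyStochastic ℝ (Fin n)) :
    softassignScore X β T ≤ softassignScore X β (softassign X β) :=
  (exists_softassign X β).choose_spec.2 T hT

theorem softassign_unique {n : ℕ} (X : Matrix (Fin n) (Fin n) ℝ) (β : ℝ) (hβ : 0 < β)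
    (S : Matrix (Fin n) (Fin n) ℝ) (hS : S ∈ doublyStochastic ℝ (Fin n))
    (hmax : ∀ T ∈ doublyStochastic ℝ (Fin n), softassignScore X β T ≤ softassignScore X β S) :
    S = softassign X β := by
  by_contra hne
  have hR := softassign_mem X β
  have hRS := hmax _ hR
  have hSR := softassign_max X β S hS
  set R := softassign X β
  set M : Matrix (Fin n) (Fin n) ℝ := (1 / 2 : ℝ) • S + (1 / 2 : ℝ) • R with hM
  have hMmem : M ∈ doublyStochastic ℝ (Fin n) :=
    convex_doublyStochastic hS hR (by norm_num) (by norm_num) (by norm_num)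
  have hMS := hmax M hMmem
  have hlin : frobeniusInner M X = (frobeniusInner S X + frobeniusInner R X) / 2 := by
    simp only [frobeniusInner_eq_sum, hM, Matrix.add_apply, Matrix.smul_apply, smul_eq_mul]
    rw [← Finset.sum_add_distrib, Finset.sum_div]
    refine Finset.sum_congr rfl fun i _ => ?_
    rw [← Finset.sum_add_distrib, Finset.sum_div]
    exact Finset.sum_congr rfl fun j _ => by ring
  have hle : ∀ i j, (Real.negMulLog (S i j) + Real.negMulLog (R i j)) / 2 ≤
      Real.negMulLog (M i j) := by
    intro i j
    have := Real.strictConcaveOn_negMulLog.concaveOn.2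
      (Set.mem_Ici.2 (nonneg_of_mem_doublyStochastic hS (i := i) (j := j)))
      (Set.mem_Ici.2 (nonneg_of_mem_doublyStochastic hR (i := i) (j := j)))
      (by norm_num : (0 : ℝ) ≤ 1 / 2) (by norm_num : (0 : ℝ) ≤ 1 / 2) (by norm_num)
    simp only [smul_eq_mul] at this
    simp only [hM, Matrix.add_apply, Matrix.smul_apply, smul_eq_mul]
    linarith
  obtain ⟨i, j, hij⟩ : ∃ i j, S i j ≠ R i j := by
    by_contra! h
    exact hne (Matrix.ext h)
  have hlt : (Real.negMulLog (S i j) + Real.negMulLog (R i j)) / 2 <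
      Real.negMulLog (M i j) := by
    have := Real.strictConcaveOn_negMulLog.2
      (Set.mem_Ici.2 (nonneg_of_mem_doublyStochastic hS (i := i) (j := j)))
      (Set.mem_Ici.2 (nonneg_of_mem_doublyStochastic hR (i := i) (j := j))) hij
      (by norm_num : (0 : ℝ) < 1 / 2) (by norm_num : (0 : ℝ) < 1 / 2) (by norm_num)
    simp only [smul_eq_mul] at this
    simp only [hM, Matrix.add_apply, Matrix.smul_apply, smul_eq_mul]
    linarith
  have hH : (matrixEntropy S + matrixEntropy R) / 2 < matrixEntropy M := by
    have e : (matrixEntropy S + matrixEntropy R) / 2 =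
        ∑ i, ∑ j, (Real.negMulLog (S i j) + Real.negMulLog (R i j)) / 2 := by
      simp only [matrixEntropy, ← Finset.sum_div, Finset.sum_add_distrib]
    rw [e]
    exact Finset.sum_lt_sum (fun i _ => Finset.sum_le_sum fun j _ => hle i j)
      ⟨i, Finset.mem_univ i, Finset.sum_lt_sum (fun j _ => hle i j) ⟨j, Finset.mem_univ j, hlt⟩⟩
  have hpos : 0 < 1 / β := by positivity
  have := mul_lt_mul_of_pos_left hH hpos
  simp only [softassignScore] at hRS hSR hMS
  rw [hlin] at hMS
  linarith

/-- The matrix `S^∞_X`: the limit of `S^β_X` as `β → ∞`. -/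
def softassignLimit {n : ℕ} (X : Matrix (Fin n) (Fin n) ℝ) : Matrix (Fin n) (Fin n) ℝ :=
  limUnder atTop fun β : ℝ => softassign X β

end

/-! By Birkhoff's theorem `S = softassign X β` is a mixture of permutation matrices. Let `l` be the
weight on non-optimal ones; moving it to an optimal one gives a point `A` of the optimal face within
`l` of `S` entrywise, and costs `S` at least `l * D` in score (`exists_assignmentFace_gap`). Let `R`
maximize entropy on the face. Comparing the scores of `S` and `R` gives `l * D * β ≤ H(S) - H(R)`,
while `H(S) - H(A) ≤ N * l * (1 - log l)` and strong concavity gives `H(A) ≤ H(R) - ‖A - R‖ ^ 2 /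
8`. Hence `l ≤ exp (1 - D * β / N)`, and `‖A - R‖ ^ 2` is at most a multiple of `√l`, so both `S -
A` and `A - R` decay exponentially. -/

/-! ### Scalar estimates for `-x log x`. -/

section ScalarInequalities

open Real

/-- The increment of `-x log x` over a step of length at most `l`. -/
theorem negMulLog_sub_le {s a l : ℝ} (hs : 0 ≤ s) (ha : 0 ≤ a) (ha1 : a ≤ 1)
    (hl : 0 < l) (hl1 : l ≤ 1) (h : |s - a| ≤ l) :
    negMulLog s - negMulLog a ≤ l * (1 - log l) := by
  have hlog : log l ≤ 0 := log_nonpos hl.le hl1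
  obtain ⟨h1, h2⟩ := abs_le.1 h
  rcases hs.eq_or_lt with rfl | hs
  · rw [negMulLog_zero, zero_sub, negMulLog, neg_mul, neg_neg]
    have := mul_nonpos_of_nonneg_of_nonpos ha (log_nonpos ha ha1)
    nlinarith
  rcases le_or_gt s a with hsa | hsa
  · have ha' : 0 < a := hs.trans_le hsa
    -- The increment is `s * log (a / s) + (a - s) * log a`, where the second term is nonpositive.
    have h3 := log_le_sub_one_of_pos (div_pos ha' hs)
    rw [log_div ha'.ne' hs.ne'] at h3
    have h4 := mul_le_mul_of_nonneg_left h3 hs.le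
    have h5 : s * (a / s - 1) = a - s := by field_simp
    rw [h5] at h4
    have h6 := mul_nonpos_of_nonneg_of_nonpos (sub_nonneg.2 hsa) (log_nonpos ha'.le ha1)
    simp only [negMulLog]
    nlinarith
  · -- Split `s = a + d`, and use that `log` is increasing.
    have hd : 0 < s - a := sub_pos.2 hsa
    have h3 : a * log a ≤ a * log s := by
      rcases ha.eq_or_lt with rfl | ha'
      · simp
      · exact mul_le_mul_of_nonneg_left (log_le_log ha' hsa.le) ha
    have h4 : (s - a) * log (s - a) ≤ (s - a) * log s :=
      mul_le_mul_of_nonneg_left (log_le_log hd (by linarith)) hd.le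
    -- With `d = s - a`, this yields `-d log d ≤ l - d - d log l`, and `d ≤ l` turns `-d log l` into
    -- `-l log l`.
    have h5 := one_sub_inv_le_log_of_pos (div_pos hd hl)
    rw [log_div hd.ne' hl.ne', inv_div] at h5
    have h6 := mul_le_mul_of_nonneg_left h5 hd.le
    have h7 : (s - a) * (1 - l / (s - a)) = s - a - l := by field_simp
    rw [h7] at h6
    have h8 := mul_nonneg_of_nonpos_of_nonpos (sub_nonpos.2 h2) hlog
    simp only [negMulLog]
    nlinarith

/-- Write `log (a / m) = 2 log (√a / √m)` and use `log x ≥ 1 - 1 / x`. Summed over `a` and `s` with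
midpoint `m`, the left sides become `(√a - √m) ^ 2 + (√s - √m) ^ 2`. -/
theorem mul_log_sub_ge {a m : ℝ} (ha : 0 ≤ a) (hm : 0 < m) :
    2 * a - 2 * (√a * √m) ≤ a * log a - a * log m := by
  rcases ha.eq_or_lt with rfl | ha
  · simp
  have hsa := sqrt_pos.2 ha
  have hsm := sqrt_pos.2 hm
  have h := one_sub_inv_le_log_of_pos (div_pos hsa hsm)
  rw [log_div hsa.ne' hsm.ne', inv_div, log_sqrt ha.le, log_sqrt hm.le] at h
  have h2 := mul_le_mul_of_nonneg_left h ha.le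
  have h3 : a * (√m / √a) = √a * √m := by
    rw [mul_div_assoc']
    nth_rw 1 [← mul_self_sqrt ha.le]
    field_simp
  nlinarith

/-- Strong midpoint concavity of `-x log x` on the unit interval. -/
theorem negMulLog_add_le_midpoint {a s : ℝ} (ha : 0 ≤ a) (hs : 0 ≤ s) (ha1 : a ≤ 1)
    (hs1 : s ≤ 1) :
    negMulLog a + negMulLog s + (a - s) ^ 2 / 8 ≤ 2 * negMulLog ((a + s) / 2) := by
  rcases (add_nonneg ha hs).eq_or_lt with h0 | h0
  · obtain rfl : a = 0 := by linarith
    obtain rfl : s = 0 := by linarith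
    simp
  set m := (a + s) / 2 with hm
  have hm0 : 0 < m := by positivity
  have h1 := mul_log_sub_ge ha hm0
  have h2 := mul_log_sub_ge hs hm0
  have ea := sq_sqrt ha
  have es := sq_sqrt hs
  have em := sq_sqrt hm0.le
  have la : √a ≤ 1 := sqrt_le_one.2 ha1
  have ls : √s ≤ 1 := sqrt_le_one.2 hs1
  have pa := sqrt_nonneg a
  have ps := sqrt_nonneg s
  -- The constant `1 / 8` comes from the factor `4` here and the `2` in `h4`.
  have h3 : (a - s) ^ 2 ≤ 4 * (√a - √s) ^ 2 := by
    have e : (a - s) ^ 2 = (√a + √s) ^ 2 * (√a - √s) ^ 2 := by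
      nth_rw 1 [← ea, ← es]
      ring
    rw [e]
    refine mul_le_mul_of_nonneg_right ?_ (sq_nonneg _)
    nlinarith
  have h4 : (√a - √s) ^ 2 ≤ 2 * ((√a - √m) ^ 2 + (√s - √m) ^ 2) := by
    nlinarith [sq_nonneg (√a + √s - 2 * √m)]
  have h5 : a * log m + s * log m = 2 * (m * log m) := by rw [hm]; ring
  simp only [negMulLog]
  nlinarith

/-- Half of the exponent is given up to absorb the logarithm, via `log √l ≥ 1 - 1 / √l`. -/
theorem mul_one_sub_log_le_sqrt {l : ℝ} (hl : 0 < l) :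
    l * (1 - log l) ≤ 3 * √l := by
  have hs := sqrt_pos.2 hl
  have h := one_sub_inv_le_log_of_pos hs
  rw [log_sqrt hl.le] at h
  have h2 := mul_le_mul_of_nonneg_left h hl.le
  have h3 : l * (√l)⁻¹ = √l := by
    nth_rw 1 [← mul_self_sqrt hl.le]
    field_simp
  nlinarith

end ScalarInequalities

/-! ### Frobenius norm and matrix entropy. -/

section Frobenius

variable {n : ℕ}

theorem frobenius_norm_sq (A : Matrix (Fin n) (Fin n) ℝ) : ‖A‖ ^ 2 = ∑ i, ∑ j, A i j ^ 2 := by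
  have h : 0 ≤ ∑ i, ∑ j, A i j ^ 2 :=
    Finset.sum_nonneg fun i _ => Finset.sum_nonneg fun j _ => sq_nonneg _
  simp only [Matrix.frobenius_norm_def, Real.rpow_two, Real.norm_eq_abs, sq_abs]
  rw [← Real.sqrt_eq_rpow, Real.sq_sqrt h]

theorem abs_frobeniusInner_le (A B : Matrix (Fin n) (Fin n) ℝ) :
    |frobeniusInner A B| ≤ ‖A‖ * ‖B‖ := by
  refine abs_le_of_sq_le_sq ?_ (by positivity)
  rw [mul_pow, frobenius_norm_sq, frobenius_norm_sq, frobeniusInner_eq_sum]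
  simp only [← Fintype.sum_prod_type']
  exact Finset.sum_mul_sq_le_sq_mul_sq _ _ _

theorem frobeniusInner_sub_left (A B C : Matrix (Fin n) (Fin n) ℝ) :
    frobeniusInner (A - B) C = frobeniusInner A C - frobeniusInner B C := by
  simp [frobeniusInner, Matrix.sub_mul]

theorem frobeniusInner_sum_smul_left {ι : Type*} (s : Finset ι) (w : ι → ℝ)
    (P : ι → Matrix (Fin n) (Fin n) ℝ) (X : Matrix (Fin n) (Fin n) ℝ) :
    frobeniusInner (∑ k ∈ s, w k • P k) X = ∑ k ∈ s, w k * frobeniusInner (P k) X := by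
  simp [frobeniusInner, Matrix.transpose_sum, Matrix.sum_mul, Matrix.trace_sum]

theorem continuous_frobeniusInner_left (X : Matrix (Fin n) (Fin n) ℝ) :
    Continuous fun S : Matrix (Fin n) (Fin n) ℝ => frobeniusInner S X := by
  have hc : ∀ i j, Continuous fun S : Matrix (Fin n) (Fin n) ℝ => S i j :=
    fun i j => (continuous_apply j).comp (continuous_apply i)
  simp only [frobeniusInner_eq_sum]
  exact continuous_finsetSum _ fun i _ => continuous_finsetSum _ fun j _ =>
    (hc i j).mul continuous_const

theorem continuous_matrixEntropy :
    Continuous fun S : Matrix (Fin n) (Fin n) ℝ => matrixEntropy S := by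
  have hc : ∀ i j, Continuous fun S : Matrix (Fin n) (Fin n) ℝ => S i j :=
    fun i j => (continuous_apply j).comp (continuous_apply i)
  exact continuous_finsetSum _ fun i _ => continuous_finsetSum _ fun j _ =>
    Real.continuous_negMulLog.comp (hc i j)

theorem matrixEntropy_add_le_midpoint {A S : Matrix (Fin n) (Fin n) ℝ}
    (hA : A ∈ doublyStochastic ℝ (Fin n)) (hS : S ∈ doublyStochastic ℝ (Fin n)) :
    matrixEntropy A + matrixEntropy S + ‖A - S‖ ^ 2 / 8 ≤
      2 * matrixEntropy ((1 / 2 : ℝ) • A + (1 / 2 : ℝ) • S) := by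
  rw [frobenius_norm_sq]
  simp only [matrixEntropy, Finset.sum_div, Finset.mul_sum, ← Finset.sum_add_distrib]
  refine Finset.sum_le_sum fun i _ => Finset.sum_le_sum fun j _ => ?_
  have := negMulLog_add_le_midpoint (nonneg_of_mem_doublyStochastic hA (i := i) (j := j))
    (nonneg_of_mem_doublyStochastic hS (i := i) (j := j)) (le_one_of_mem_doublyStochastic hA)
    (le_one_of_mem_doublyStochastic hS)
  convert! this using 3
  simp only [Matrix.add_apply, Matrix.smul_apply, smul_eq_mul]
  ring

theorem matrixEntropy_sub_le {S A : Matrix (Fin n) (Fin n) ℝ} {l : ℝ}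
    (hS : S ∈ doublyStochastic ℝ (Fin n)) (hA : A ∈ doublyStochastic ℝ (Fin n))
    (hl : 0 < l) (hl1 : l ≤ 1) (h : ∀ i j, |S i j - A i j| ≤ l) :
    matrixEntropy S - matrixEntropy A ≤ (n : ℝ) ^ 2 * (l * (1 - Real.log l)) := by
  simp only [matrixEntropy, ← Finset.sum_sub_distrib]
  calc _ ≤ ∑ _i : Fin n, ∑ _j : Fin n, l * (1 - Real.log l) :=
        Finset.sum_le_sum fun i _ => Finset.sum_le_sum fun j _ =>
          negMulLog_sub_le (nonneg_of_mem_doublyStochastic hS)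
            (nonneg_of_mem_doublyStochastic hA) (le_one_of_mem_doublyStochastic hA) hl hl1 (h i j)
    _ = _ := by simp; ring

theorem frobenius_norm_sq_le_of_abs_le {A : Matrix (Fin n) (Fin n) ℝ} {l : ℝ}
    (h : ∀ i j, |A i j| ≤ l) : ‖A‖ ^ 2 ≤ (n : ℝ) ^ 2 * l ^ 2 := by
  rw [frobenius_norm_sq]
  calc _ ≤ ∑ _i : Fin n, ∑ _j : Fin n, l ^ 2 :=
        Finset.sum_le_sum fun i _ => Finset.sum_le_sum fun j _ => by
          rw [← sq_abs]
          exact pow_le_pow_left₀ (abs_nonneg _) (h i j) 2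
    _ = _ := by simp; ring

end Frobenius

/-! ### The optimal face and the exponential rate. -/

section Assignment

variable {n : ℕ}

/-- The optimal solutions of the linear assignment problem `max ⟨S, X⟩`. -/
def assignmentFace (X : Matrix (Fin n) (Fin n) ℝ) : Set (Matrix (Fin n) (Fin n) ℝ) :=
  {S | S ∈ doublyStochastic ℝ (Fin n) ∧
    ∀ T ∈ doublyStochastic ℝ (Fin n), frobeniusInner T X ≤ frobeniusInner S X}

theorem isCompact_assignmentFace (X : Matrix (Fin n) (Fin n) ℝ) :
    IsCompact (assignmentFace X) := by
  have hclosed : IsClosed {S : Matrix (Fin n) (Fin n) ℝ |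
      ∀ T ∈ doublyStochastic ℝ (Fin n), frobeniusInner T X ≤ frobeniusInner S X} := by
    simp only [Set.ofPred_forall]
    exact isClosed_iInter fun T => isClosed_iInter fun _ =>
      isClosed_le continuous_const (continuous_frobeniusInner_left X)
  exact (isCompact_doublyStochastic n).inter_right hclosed

/-- Near-optimal doubly stochastic matrices are close to the optimal face, with a linear rate. -/
theorem exists_assignmentFace_gap (X : Matrix (Fin n) (Fin n) ℝ) :
    ∃ D : ℝ, 0 < D ∧ ∀ S ∈ doublyStochastic ℝ (Fin n), ∃ A ∈ assignmentFace X, ∃ l : ℝ,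
      0 ≤ l ∧ l ≤ 1 ∧ (∀ i j, |S i j - A i j| ≤ l) ∧
      l * D ≤ frobeniusInner A X - frobeniusInner S X := by
  classical
  let P : Equiv.Perm (Fin n) → Matrix (Fin n) (Fin n) ℝ := fun σ => σ.permMatrix ℝ
  have hP : ∀ σ, P σ ∈ doublyStochastic ℝ (Fin n) := fun σ => permMatrix_mem_doublyStochastic
  obtain ⟨σ₀, hσ₀⟩ := Finite.exists_max fun σ => frobeniusInner (P σ) X
  set v := frobeniusInner (P σ₀) X with hv
  have hle : ∀ T ∈ doublyStochastic ℝ (Fin n), frobeniusInner T X ≤ v := by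
    intro T hT
    obtain ⟨w, hw, hw1, rfl⟩ := exists_eq_sum_perm_of_mem_doublyStochastic hT
    rw [frobeniusInner_sum_smul_left, ← one_mul v, ← hw1, Finset.sum_mul]
    exact Finset.sum_le_sum fun σ _ => mul_le_mul_of_nonneg_left (hσ₀ σ) (hw σ)
  obtain ⟨D, hD, hgap⟩ : ∃ D : ℝ, 0 < D ∧
      ∀ σ, frobeniusInner (P σ) X ≠ v → D ≤ v - frobeniusInner (P σ) X := by
    -- The dummy value `1` keeps the minimum positive even if every permutation is optimal.
    obtain ⟨τ, hτ⟩ := Finite.exists_min fun σ =>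
      if frobeniusInner (P σ) X = v then 1 else v - frobeniusInner (P σ) X
    refine ⟨_, ?_, fun σ hσ => (hτ σ).trans (if_neg hσ).le⟩
    split_ifs with h
    · exact one_pos
    · exact sub_pos.2 ((hσ₀ τ).lt_of_ne h)
  refine ⟨D, hD, fun S hS => ?_⟩
  obtain ⟨w, hw, hw1, rfl⟩ := exists_eq_sum_perm_of_mem_doublyStochastic hS
  -- `f` reroutes non-optimal permutations to `σ₀`; `b` marks them, so `l = ∑ σ, w σ * b σ`.
  let f : Equiv.Perm (Fin n) → Equiv.Perm (Fin n) := fun σ =>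
    if frobeniusInner (P σ) X = v then σ else σ₀
  let b : Equiv.Perm (Fin n) → ℝ := fun σ => if frobeniusInner (P σ) X = v then 0 else 1
  have hf : ∀ σ, frobeniusInner (P (f σ)) X = v := by
    intro σ
    by_cases h : frobeniusInner (P σ) X = v
    · simp only [f, h, if_true]
    · simp only [f, h, if_false, ← hv]
  have hb0 : ∀ σ, 0 ≤ b σ := fun σ => by dsimp only [b]; split_ifs <;> norm_num
  have hb1 : ∀ σ, b σ ≤ 1 := fun σ => by dsimp only [b]; split_ifs <;> norm_num
  have hA : frobeniusInner (∑ σ, w σ • P (f σ)) X = v := by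
    rw [frobeniusInner_sum_smul_left]
    simp only [hf]
    rw [← Finset.sum_mul, hw1, one_mul]
  refine ⟨∑ σ, w σ • P (f σ), ⟨?_, fun T hT => (hle T hT).trans hA.ge⟩, ∑ σ, w σ * b σ,
    Finset.sum_nonneg fun σ _ => mul_nonneg (hw σ) (hb0 σ), ?_, ?_, ?_⟩
  · exact convex_doublyStochastic.sum_mem (fun σ _ => hw σ) hw1 fun σ _ => hP (f σ)
  · rw [← hw1]
    exact Finset.sum_le_sum fun σ _ => mul_le_of_le_one_right (hw σ) (hb1 σ)
  · intro i j
    simp only [Matrix.sum_apply, Matrix.smul_apply, smul_eq_mul]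
    rw [← Finset.sum_sub_distrib]
    refine (Finset.abs_sum_le_sum_abs _ _).trans (Finset.sum_le_sum fun σ _ => ?_)
    rw [← mul_sub, abs_mul, abs_of_nonneg (hw σ)]
    refine mul_le_mul_of_nonneg_left ?_ (hw σ)
    by_cases h : frobeniusInner (P σ) X = v
    · simp [f, b, h, P]
    · simp only [f, b, h, if_false]
      have h1 := nonneg_of_mem_doublyStochastic (hP σ) (i := i) (j := j)
      have h2 := le_one_of_mem_doublyStochastic (hP σ) (i := i) (j := j)
      have h3 := nonneg_of_mem_doublyStochastic (hP σ₀) (i := i) (j := j)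
      have h4 := le_one_of_mem_doublyStochastic (hP σ₀) (i := i) (j := j)
      simp only [P] at h1 h2 h3 h4
      exact abs_le.2 ⟨by linarith, by linarith⟩
  · rw [hA, frobeniusInner_sum_smul_left, ← one_mul v, ← hw1, Finset.sum_mul, Finset.sum_mul,
      ← Finset.sum_sub_distrib]
    refine Finset.sum_le_sum fun σ _ => ?_
    rw [mul_assoc, ← mul_sub]
    refine mul_le_mul_of_nonneg_left ?_ (hw σ)
    by_cases h : frobeniusInner (P σ) X = v
    · simp only [b, h, if_true, zero_mul]
      exact sub_nonneg.2 (hσ₀ σ)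
    · simpa [b, h] using hgap σ h

/-- The entropy maximizer on the optimal face attracts `softassign X β` at an exponential rate. -/
theorem exists_softassign_exponential_bound (X : Matrix (Fin n) (Fin n) ℝ) :
    ∃ R ∈ assignmentFace X, ∃ C μ : ℝ, 0 < C ∧ 0 < μ ∧ ∀ β : ℝ, 0 < β →
      ‖softassign X β - R‖ ≤ C * Real.exp (-μ * β) := by
  obtain ⟨D, hD, hgap⟩ := exists_assignmentFace_gap X
  obtain ⟨A₁, hA₁, -⟩ := hgap 1 (doublyStochastic ℝ (Fin n)).one_mem
  obtain ⟨R, hR, hRmax⟩ := (isCompact_assignmentFace X).exists_isMaxOn ⟨A₁, hA₁⟩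
    continuous_matrixEntropy.continuousOn
  -- The `+ 1` keeps `N` positive for `n = 0` and gives `N ≤ N ^ 2`.
  set N : ℝ := (n : ℝ) ^ 2 + 1 with hN
  have hN1 : 1 ≤ N := by rw [hN]; nlinarith [sq_nonneg (n : ℝ)]
  have hN0 : 0 < N := by linarith
  have hnN : (n : ℝ) ^ 2 ≤ N := by linarith
  have hstrong : ∀ A ∈ assignmentFace X,
      matrixEntropy A ≤ matrixEntropy R - ‖A - R‖ ^ 2 / 8 := by
    intro A hA
    have hmid : (1 / 2 : ℝ) • A + (1 / 2 : ℝ) • R ∈ assignmentFace X := by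
      refine ⟨convex_doublyStochastic hA.1 hR.1 (by norm_num) (by norm_num) (by norm_num),
        fun T hT => ?_⟩
      have h1 := hA.2 T hT
      have h2 := hR.2 T hT
      have h3 : frobeniusInner ((1 / 2 : ℝ) • A + (1 / 2 : ℝ) • R) X =
          (frobeniusInner A X + frobeniusInner R X) / 2 := by
        simp [frobeniusInner, Matrix.add_mul]
        ring
      linarith
    have h1 : matrixEntropy ((1 / 2 : ℝ) • A + (1 / 2 : ℝ) • R) ≤ matrixEntropy R := hRmax hmid
    have h2 := matrixEntropy_add_le_midpoint hA.1 hR.1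
    linarith
  refine ⟨R, hR, 6 * N * Real.exp (1 / 4), D / (4 * N), by positivity, by positivity,
    fun β hβ => ?_⟩
  set S := softassign X β with hSdef
  have hS : S ∈ doublyStochastic ℝ (Fin n) := softassign_mem X β
  obtain ⟨A, hA, l, hl0, hl1, hSA, hlD⟩ := hgap S hS
  have hAR : frobeniusInner A X = frobeniusInner R X := le_antisymm (hR.2 A hA.1) (hA.2 R hR.1)
  have hopt : l * D * β ≤ matrixEntropy S - matrixEntropy R := by
    have h := softassign_max X β R hR.1
    rw [← hSdef, softassignScore, softassignScore] at h
    have h1 : l * D ≤ (matrixEntropy S - matrixEntropy R) / β := by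
      rw [sub_div, div_eq_mul_one_div, div_eq_mul_one_div (matrixEntropy R)]
      linarith
    exact (le_div_iff₀ hβ).1 h1
  have hARs := hstrong A hA
  -- A fourth root: `l ≤ E ^ 4` gives `√l ≤ E ^ 2`, which bounds squared norms.
  set E := Real.exp ((1 - D * β / N) / 4) with hE
  have hE0 : 0 < E := Real.exp_pos _
  have hbounds : ‖A - R‖ ^ 2 ≤ (5 * N * E) ^ 2 ∧ ‖S - A‖ ^ 2 ≤ (N * E) ^ 2 := by
    have hSAn : ‖S - A‖ ^ 2 ≤ (n : ℝ) ^ 2 * l ^ 2 := frobenius_norm_sq_le_of_abs_le hSA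
    have hNN : N ≤ N ^ 2 := by nlinarith
    -- If `l = 0`, then `S = A` has entropy at least that of `R`, forcing `A = R`.
    rcases hl0.eq_or_lt with rfl | hl
    · have : S = A := Matrix.ext fun i j => sub_eq_zero.1 (abs_nonpos_iff.1 (hSA i j))
      rw [this] at hopt ⊢
      constructor
      · nlinarith [sq_nonneg (5 * N * E)]
      · simpa using sq_nonneg (N * E)
    have hlog : Real.log l ≤ 0 := Real.log_nonpos hl.le hl1
    have hent : matrixEntropy S - matrixEntropy A ≤ N * (l * (1 - Real.log l)) :=
      (matrixEntropy_sub_le hS hA.1 hl hl1 hSA).trans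
        (mul_le_mul_of_nonneg_right hnN (mul_nonneg hl.le (by linarith)))
    have hlE : l ≤ E ^ 4 := by
      have h1 : l * (D * β) ≤ l * (N * (1 - Real.log l)) := by
        nlinarith [sq_nonneg ‖A - R‖]
      have h2 : D * β ≤ N * (1 - Real.log l) := le_of_mul_le_mul_left h1 hl
      have h3 : D * β / N ≤ 1 - Real.log l := by rwa [div_le_iff₀' hN0]
      rw [hE, ← Real.exp_nat_mul, ← Real.log_le_iff_le_exp hl]
      push_cast
      linarith
    have hsE : √l ≤ E ^ 2 := Real.sqrt_le_iff.2 ⟨by positivity, by rw [← pow_mul]; exact hlE⟩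
    have hlsq : l ^ 2 ≤ √l := by
      refine Real.le_sqrt_of_sq_le ?_
      rw [← pow_mul]
      exact pow_le_of_le_one hl.le hl1 (by norm_num)
    have hsq := mul_one_sub_log_le_sqrt hl
    constructor
    · have h1 : 0 ≤ l * D * β := by positivity
      -- `24 = 8 * 3`, from strong concavity and the `3 * √l` bound; it is then rounded up to `5 ^
      -- 2`.
      have h2 : ‖A - R‖ ^ 2 ≤ 24 * (N * E ^ 2) := by
        have := mul_le_mul_of_nonneg_left (hsq.trans (mul_le_mul_of_nonneg_left hsE
          (by norm_num : (0 : ℝ) ≤ 3))) hN0.le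
        linarith
      have h3 := mul_le_mul_of_nonneg_right hNN (sq_nonneg E)
      have h4 : 0 ≤ N * E ^ 2 := by positivity
      nlinarith
    · calc ‖S - A‖ ^ 2 ≤ (n : ℝ) ^ 2 * l ^ 2 := hSAn
        _ ≤ N ^ 2 * E ^ 2 := mul_le_mul (hnN.trans hNN) (hlsq.trans hsE) (sq_nonneg _)
            (sq_nonneg _)
        _ = (N * E) ^ 2 := by ring
  have h1 : ‖A - R‖ ≤ 5 * N * E := le_of_sq_le_sq hbounds.1 (by positivity)
  have h2 : ‖S - A‖ ≤ N * E := le_of_sq_le_sq hbounds.2 (by positivity)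
  have h3 : E = Real.exp (1 / 4) * Real.exp (-(D / (4 * N)) * β) := by
    rw [hE, ← Real.exp_add]
    congr 1
    field_simp
    ring
  calc ‖S - R‖ ≤ ‖S - A‖ + ‖A - R‖ := norm_sub_le_norm_sub_add_norm_sub _ _ _
    _ ≤ 6 * N * E := by linarith
    _ = _ := by rw [h3]; ring

end Assignment

theorem proposition1 (n : ℕ) (X : Matrix (Fin n) (Fin n) ℝ) :
    (Tendsto (fun β : ℝ => softassign X β) atTop (𝓝 (softassignLimit X)) ∧
      softassignLimit X ∈ doublyStochastic ℝ (Fin n) ∧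
      ∀ T ∈ doublyStochastic ℝ (Fin n),
        frobeniusInner T X ≤ frobeniusInner (softassignLimit X) X) ∧
    (∀ β : ℝ, 0 < β →
      |frobeniusInner (softassign X β) X - frobeniusInner (softassignLimit X) X| ≤
        ‖softassign X β - softassignLimit X‖ * ‖X‖) ∧
    ∃ c μ : ℝ, 0 < c ∧ 0 < μ ∧ ∀ β : ℝ, 0 < β →
      ‖softassign X β - softassignLimit X‖ ≤ c / μ * Real.exp (-μ * β) := by
  obtain ⟨R, hR, C, μ, hC, hμ, hbound⟩ := exists_softassign_exponential_bound X
  have hlim : Tendsto (fun β : ℝ => softassign X β) atTop (𝓝 R) := by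
    refine tendsto_iff_norm_sub_tendsto_zero.2 ?_
    have hexp : Tendsto (fun β : ℝ => C * Real.exp (-μ * β)) atTop (𝓝 0) := by
      have h := (Real.tendsto_exp_atBot.comp
        (tendsto_id.const_mul_atTop_of_neg (neg_lt_zero.2 hμ))).const_mul C
      simpa using h
    refine squeeze_zero' (Eventually.of_forall fun β => norm_nonneg _) ?_ hexp
    filter_upwards [eventually_gt_atTop (0 : ℝ)] with β hβ using hbound β hβ
  have hRlim : softassignLimit X = R := hlim.limUnder_eq
  rw [hRlim]
  -- `c = C * μ` makes `c / μ` equal to `C`.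
  refine ⟨⟨hlim, hR⟩, fun β _ => ?_, C * μ, μ, by positivity, hμ, fun β hβ => ?_⟩
  · rw [← frobeniusInner_sub_left]
    exact abs_frobeniusInner_le _ _
  · rw [mul_div_cancel_right₀ _ hμ.ne']
    exact hbound β hβ
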